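/- Let $\overline X$ be a compact connected Riemann surface, $\rho:\pi_1(\overline X)\to GL(n,\mathbb C)$ a representation and $L_\rho$ the corresponding flat complex vector bundle on $\overline X$, with flat connection $D=d'+d''$ ($d'$ of type $(1,0)$, $d''$ of type $(0,1)$). Let $p_i\in\overline X$ and let $t_i$ be a holomorphic coordinate centred at $p_i$ whose range contains the closed unit disk; put $r_i=|t_i|$ and $\Delta_i^*=\{0<r_i<1\}$. For a Hermitian metric $K$ on $L_\rho$, let $\delta'$, $\delta''$ be the operators of type $(1,0)$, $(0,1)$ for which both $\delta'+d''$ and $d'+\delta''$ preserve $K$, and put $\theta_K=(d'-\delta')/2$, $\overline\partial_K=(d''+\delta'')/2$. Then $K$ is called harmonic on $\Delta_i^*$ if it is of class $C^2$ there and $\Lambda\big((\overline\partial_K+\theta_K)^2\big)=0$, where $\Lambda$ is the adjoint of the wedge product with $\omega=\sqrt{-1}\,dt_i\wedge d\overline t_i$. Two metrics $K,K_0$ are called mutually bounded on $\Delta_i^*$ if, writing $\langle u,v\rangle_K=\langle hu,v\rangle_{K_0}$ with $h$ an endomorphism of $L_\rho$, the eigenvalues of $h$ are uniformly bounded away from $0$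 and $\infty$ on $\Delta_i^*$. Let $K_0$ be any Hermitian metric on $L_\rho$ over $\{0<r_i\le1\}$ (no regularity or harmonicity of $K_0$ is needed). Let $K,K'$ be two Hermitian metrics on $L_\rho$ over $\{0<r_i\le 1\}$ that are continuous there, harmonic on $\Delta_i^*$, equal on the circle $r_i=1$, and both mutually bounded with $K_0$ on $\Delta_i^*$. Then $K\equiv K'$. -/

import Mathlib

open scoped Manifold ContDiff Matrix

noncomputable section

namespace FlatHarmonic

/-! ### The flat bundle of a representation of the fundamental group -/

section Bundle

variable {X : Type*} [TopologicalSpace X] {x₀ : X} {n : ℕ}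

/-- The fibre at `x` of the flat vector bundle `L_ρ = X̃ ×_{π₁} ℂⁿ`. The points of the universal
covering over `x` are the homotopy classes of paths from `x` to the base point `x₀`, on which
`π₁(X, x₀)` acts on the left by `α • γ = γ.trans α`; a vector of `L_ρ` at `x` is a `ρ`-equivariant
`ℂⁿ`-valued function on these points. -/
def Fiber (ρ : FundamentalGroup X x₀ →* GL (Fin n) ℂ) (x : X) :
    Submodule ℂ (Path.Homotopic.Quotient x x₀ → Fin n → ℂ) where
  carrier := {s | ∀ (α : FundamentalGroup X x₀) (γ : Path.Homotopic.Quotient x x₀),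
    s (γ.trans α.toPath) = (ρ α : Matrix (Fin n) (Fin n) ℂ) *ᵥ s γ}
  add_mem' := by
    intro s s' hs hs' α γ
    simp only [Pi.add_apply, hs α γ, hs' α γ, Matrix.mulVec_add]
  zero_mem' := by
    intro α γ
    simp
  smul_mem' := by
    intro c s hs α γ
    simp only [Pi.smul_apply, hs α γ, Matrix.mulVec_smul]

/-- The vector of `L_ρ` at `x` whose value at the point `γ` of the universal covering is `w`.
When `γ` moves continuously (that is, by parallel transport), these vectors form a flat section. -/
def flatVector (ρ : FundamentalGroup X x₀ →* GL (Fin n) ℂ) {x : X}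
    (γ : Path.Homotopic.Quotient x x₀) (w : Fin n → ℂ) : Fiber ρ x :=
  ⟨fun γ' => (ρ (FundamentalGroup.fromPath (γ.symm.trans γ')) : Matrix (Fin n) (Fin n) ℂ) *ᵥ w, by
    intro α γ'
    have h : FundamentalGroup.fromPath (γ.symm.trans (γ'.trans α.toPath)) =
        α * FundamentalGroup.fromPath (γ.symm.trans γ') := by
      rw [FundamentalGroup.mul_def]
      exact (Path.Homotopic.Quotient.trans_assoc _ _ _).symm
    simp only [h, map_mul, Units.val_mul, Matrix.mulVec_mulVec]⟩

/-- A Hermitian metric on `L_ρ` over `U`: a Hermitian inner product on every fibre over `U`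
(conjugate linear in the first variable). Regularity is imposed separately. -/
def HermitianMetric (ρ : FundamentalGroup X x₀ →* GL (Fin n) ℂ) (U : Set X) :=
  ∀ x : U, InnerProductSpace.Core ℂ (Fiber ρ (x : X))

/-- `K` and `K₀` are mutually bounded on `V`: in `K = h K₀`, that is `⟨u, v⟩_K = ⟨h u, v⟩_{K₀}` with
`h` an endomorphism of `L_ρ`, the eigenvalues of `h` stay uniformly away from `0` and `∞`. -/
def MutuallyBoundedOn {ρ : FundamentalGroup X x₀ →* GL (Fin n) ℂ} {U : Set X}
    (K K₀ : HermitianMetric ρ U) (V : Set X) : Prop :=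
  ∃ c C : ℝ, 0 < c ∧ ∀ x : U, (x : X) ∈ V →
    ∃ h : Module.End ℂ (Fiber ρ (x : X)),
      (∀ u v, (K x).inner v u = (K₀ x).inner v (h u)) ∧
      ∀ μ : ℂ, h.HasEigenvalue μ → c ≤ ‖μ‖ ∧ ‖μ‖ ≤ C

end Bundle

/-! ### Calculus with matrix functions of one complex variable -/

section Calculus

variable {n : ℕ}

/-- `∂f/∂t = (∂f/∂x - i ∂f/∂y) / 2`. -/
def wirtinger (f : ℂ → ℂ) (t : ℂ) : ℂ :=
  (fderiv ℝ f t 1 - Complex.I * fderiv ℝ f t Complex.I) / 2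

/-- `∂f/∂t̄ = (∂f/∂x + i ∂f/∂y) / 2`. -/
def wirtingerBar (f : ℂ → ℂ) (t : ℂ) : ℂ :=
  (fderiv ℝ f t 1 + Complex.I * fderiv ℝ f t Complex.I) / 2

/-- `∂A/∂t`, entry by entry. -/
def matrixD (A : ℂ → Matrix (Fin n) (Fin n) ℂ) (t : ℂ) : Matrix (Fin n) (Fin n) ℂ :=
  Matrix.of fun i j => wirtinger (fun s => A s i j) t

/-- `∂A/∂t̄`, entry by entry. -/
def matrixDBar (A : ℂ → Matrix (Fin n) (Fin n) ℂ) (t : ℂ) : Matrix (Fin n) (Fin n) ℂ :=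
  Matrix.of fun i j => wirtingerBar (fun s => A s i j) t

/-- The `(1,0)`-form `θ_K = (d' - δ') / 2` of the metric with Gram matrix `G i j = ⟨v_j, v_i⟩_K`
in a flat frame `v`, as the coefficient of `dt`, a matrix acting on coordinate columns in the
frame: `∂⟨v_j, v_i⟩_K = ⟨δ' v_j, v_i⟩_K = -2 ⟨θ_K v_j, v_i⟩_K`, that is `∂G = -2 G θ_K`. -/
def theta (G : ℂ → Matrix (Fin n) (Fin n) ℂ) (t : ℂ) : Matrix (Fin n) (Fin n) ℂ :=
  (-1 / 2 : ℂ) • ((G t)⁻¹ * matrixD G t)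

/-- The `(0,1)`-form `θ̄_K = (d'' - δ'') / 2`, as the coefficient of `dt̄`: `∂̄G = -2 G θ̄_K`. -/
def thetaBar (G : ℂ → Matrix (Fin n) (Fin n) ℂ) (t : ℂ) : Matrix (Fin n) (Fin n) ℂ :=
  (-1 / 2 : ℂ) • ((G t)⁻¹ * matrixDBar G t)

/-- The pseudo-curvature `G_K = (D''_K)²` of the Higgs operator `D''_K = ∂̄_K + θ_K`, where
`∂̄_K = (d'' + δ'') / 2 = d'' - θ̄_K` and `d'' = ∂̄` in a flat frame. In complex dimension one
`(∂̄_K)² = θ_K ∧ θ_K = 0`, so `G_K = ∂̄θ_K - (θ̄_K ∧ θ_K + θ_K ∧ θ̄_K)`; this is its coefficient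
of `dt̄ ∧ dt`. -/
def pseudoCurvature (G : ℂ → Matrix (Fin n) (Fin n) ℂ) (t : ℂ) : Matrix (Fin n) (Fin n) ℂ :=
  matrixDBar (theta G) t - (thetaBar G t * theta G t - theta G t * thetaBar G t)

/-- `Λ G_K`, where `Λ` is the adjoint of the wedge product with `ω = i dt ∧ dt̄`; it takes
`dt̄ ∧ dt = i ω` to `i`. (Another Kähler form on the disk would multiply this by a positive
function.) -/
def lambdaPseudoCurvature (G : ℂ → Matrix (Fin n) (Fin n) ℂ) (t : ℂ) :
    Matrix (Fin n) (Fin n) ℂ :=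
  Complex.I • pseudoCurvature G t

end Calculus

/-! ### Coordinate disks in a Riemann surface, and harmonic metrics on the punctured disk -/

/-- `0 < |t| < 1`. -/
def puncturedDisk : Set ℂ := {t | 0 < ‖t‖ ∧ ‖t‖ < 1}

/-- `0 < |t| ≤ 1`. -/
def closedPuncturedDisk : Set ℂ := {t | 0 < ‖t‖ ∧ ‖t‖ ≤ 1}

/-- A holomorphic coordinate `t` of the Riemann surface `X` whose range contains the closed unit
disk. The centre `t = 0` is the puncture. -/
structure CoordinateDisk (X : Type*) [TopologicalSpace X] [ChartedSpace ℂ X] where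
  /-- the coordinate -/
  chart : OpenPartialHomeomorph X ℂ
  chart_mem : chart ∈ IsManifold.maximalAtlas 𝓘(ℂ) ω X
  closedBall_subset : Metric.closedBall (0 : ℂ) 1 ⊆ chart.target

namespace CoordinateDisk

variable {X : Type*} [TopologicalSpace X] [ChartedSpace ℂ X] (D : CoordinateDisk X)

/-- The point of the surface with coordinate `t`. -/
def point (t : ℂ) : X := D.chart.symm t

/-- The puncture. -/
def center : X := D.point 0

/-- The punctured disk `Δ* = {0 < |t| < 1}` in the surface. -/
def punctured : Set X := {x | x ∈ D.chart.source ∧ D.chart x ∈ puncturedDisk}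

/-- The punctured disk together with its boundary circle, `{0 < |t| ≤ 1}`, in the surface. -/
def closedPunctured : Set X := {x | x ∈ D.chart.source ∧ D.chart x ∈ closedPuncturedDisk}

theorem mem_target {t : ℂ} (ht : t ∈ closedPuncturedDisk) : t ∈ D.chart.target :=
  D.closedBall_subset (by simpa using ht.2)

theorem point_mem {t : ℂ} (ht : t ∈ closedPuncturedDisk) : D.point t ∈ D.closedPunctured :=
  ⟨D.chart.map_target (D.mem_target ht), by
    simpa only [point, D.chart.right_inv (D.mem_target ht)] using ht⟩

/-- The radial path in the disk from the point with coordinate `t` to the puncture. -/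
def radialPath {t : ℂ} (ht : t ∈ closedPuncturedDisk) : Path (D.point t) D.center where
  toFun s := D.point ((1 - (s : ℝ) : ℝ) * t)
  continuous_toFun := by
    refine D.chart.continuousOn_symm.comp_continuous (by fun_prop) fun s => ?_
    refine D.closedBall_subset ?_
    have h0 : 0 ≤ 1 - (s : ℝ) := sub_nonneg.2 s.2.2
    have h1 : 1 - (s : ℝ) ≤ 1 := sub_le_self _ s.2.1
    rw [mem_closedBall_zero_iff, norm_mul, Complex.norm_real, Real.norm_of_nonneg h0]
    exact mul_le_one₀ h1 (norm_nonneg _) ht.2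
  source' := by simp
  target' := by simp [center]

variable {x₀ : X} {n : ℕ} {ρ : FundamentalGroup X x₀ →* GL (Fin n) ℂ}

/-- The flat frame of `L_ρ` over the disk that is determined by a point `γ` of the universal
covering over the centre: at the point with coordinate `t` it consists of the vectors whose values
at `γ`, continued along the radius, are the standard basis vectors of `ℂⁿ`. -/
def flatFrame (ρ : FundamentalGroup X x₀ →* GL (Fin n) ℂ)
    (γ : Path.Homotopic.Quotient D.center x₀) {t : ℂ} (ht : t ∈ closedPuncturedDisk)
    (i : Fin n) : Fiber ρ (D.point t) :=
  flatVector ρ ((Path.Homotopic.Quotient.mk (D.radialPath ht)).trans γ) (Pi.single i 1)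

open Classical in
/-- The Gram matrix of the metric `K` in the flat frame, as a function of the coordinate `t` with
`0 < |t| ≤ 1` (and `0` for other `t`). -/
def gram (K : HermitianMetric ρ D.closedPunctured) (γ : Path.Homotopic.Quotient D.center x₀)
    (t : ℂ) : Matrix (Fin n) (Fin n) ℂ :=
  if ht : t ∈ closedPuncturedDisk then
    Matrix.of fun i j => (K ⟨D.point t, D.point_mem ht⟩).inner
      (D.flatFrame ρ γ ht i) (D.flatFrame ρ γ ht j)
  else 0

/-- The metric `K` is continuous on `{0 < |t| ≤ 1}`. -/
def IsContinuousMetric (K : HermitianMetric ρ D.closedPunctured) : Prop :=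
  ∀ γ : Path.Homotopic.Quotient D.center x₀, ContinuousOn (D.gram K γ) closedPuncturedDisk

/-- The metric `K` is harmonic on `Δ* = {0 < |t| < 1}`: it is of class `C²` there and `Λ G_K = 0`. -/
def IsHarmonicMetric (K : HermitianMetric ρ D.closedPunctured) : Prop :=
  ∀ γ : Path.Homotopic.Quotient D.center x₀,
    (∀ i j, ContDiffOn ℝ 2 (fun t => D.gram K γ t i j) puncturedDisk) ∧
    ∀ t ∈ puncturedDisk, lambdaPseudoCurvature (D.gram K γ) t = 0

end CoordinateDisk

end FlatHarmonic

end

/-!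
In a flat frame over the disk, with Gram matrices `G` and `H` of the two metrics, harmonicity is the
equation `ΔG = ∑ₐ ∂ₐG G⁻¹ ∂ₐG` (the sum over the two real directions `a`) of a harmonic map into the
space of positive definite matrices (`harmonicEquationAt_of_lambdaPseudoCurvature_eq_zero`). For two
solutions,
`Δ tr(G⁻¹H) = ∑ₐ tr(G⁻¹ Mₐ H⁻¹ Mₐᴴ) ≥ 0` with `Mₐ = ∂ₐH - ∂ₐG G⁻¹ H`,
so `tr(G⁻¹H)` is subharmonic on the punctured disk (`laplacian_re_trace_inv_mul_nonneg`). It is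
bounded, since mutual boundedness of both metrics with `K₀` gives `H ≤ aG` for a constant `a`
(`CoordinateDisk.exists_posSemidef_smul_gram_sub_gram`), and it equals `n` on the unit circle. A
bounded subharmonic function does not see the puncture: adding a small multiple of `log |t|` and
applying the maximum principle on an annulus gives `tr(G⁻¹H) ≤ n` everywhere
(`le_of_subharmonic_of_bounded`). By symmetry `tr(H⁻¹G) ≤ n`, and from
`tr(G⁻¹H) + tr(H⁻¹G) - 2n = tr(G⁻¹(H - G)H⁻¹(H - G)) ≥ 0`, which vanishes only for `G = H`
(`eq_of_re_trace_inv_mul_le`), the Gram matrices agree.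
-/

namespace FlatHarmonic

open Filter Topology Laplacian

/-! ### The maximum principle on the punctured disk -/

/-- The second-order necessary condition for a local maximum, in each direction. -/
theorem iteratedFDeriv_two_nonpos_of_isLocalMax {E : Type*} [NormedAddCommGroup E]
    [NormedSpace ℝ E] {f : E → ℝ} {x : E} (hmax : IsLocalMax f x) (hf : ContDiffAt ℝ 2 f x)
    (v : E) : iteratedFDeriv ℝ 2 f x ![v, v] ≤ 0 := by
  by_contra! hpos
  have hline : ∀ s : ℝ, HasDerivAt (fun s : ℝ => x + s • v) v s := fun s => by
    simpa using ((hasDerivAt_id s).smul_const v).const_add x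
  have htend : Tendsto (fun s : ℝ => x + s • v) (𝓝 0) (𝓝 x) := by
    simpa using (hline 0).continuousAt.tendsto
  have hd : ∀ᶠ s : ℝ in 𝓝 0, HasDerivAt (fun s : ℝ => f (x + s • v)) (fderiv ℝ f (x + s • v) v) s := by
    have h1 : ∀ᶠ y in 𝓝 x, ContDiffAt ℝ 2 f y := hf.eventually (by simp)
    filter_upwards [htend.eventually h1] with s hs
    exact (hs.differentiableAt (by norm_num)).hasFDerivAt.comp_hasDerivAt s (hline s)
  have hd1 : deriv (fun s : ℝ => f (x + s • v)) =ᶠ[𝓝 0] fun s => fderiv ℝ f (x + s • v) v := by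
    filter_upwards [hd] with s hs using hs.deriv
  have hd2 : HasDerivAt (deriv fun s : ℝ => f (x + s • v)) (iteratedFDeriv ℝ 2 f x ![v, v]) 0 := by
    refine HasDerivAt.congr_of_eventuallyEq ?_ hd1
    have h2 : DifferentiableAt ℝ (fderiv ℝ f) x :=
      (hf.fderiv_right (m := 1) (by norm_num)).differentiableAt (by norm_num)
    have h3 : HasFDerivAt (fderiv ℝ f) (fderiv ℝ (fderiv ℝ f) x) (x + (0 : ℝ) • v) := by
      simpa using h2.hasFDerivAt
    have h4 : HasDerivAt (fun s : ℝ => fderiv ℝ f (x + s • v)) (fderiv ℝ (fderiv ℝ f) x v) 0 :=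
      HasFDerivAt.comp_hasDerivAt (f := fun s : ℝ => x + s • v) (0 : ℝ) h3 (hline 0)
    have h5 := (ContinuousLinearMap.apply ℝ ℝ v).hasFDerivAt.comp_hasDerivAt (0 : ℝ) h4
    rw [iteratedFDeriv_two_apply]
    exact h5
  have hmax' : IsLocalMax (fun s : ℝ => f (x + s • v)) 0 := by
    have : ∀ᶠ s : ℝ in 𝓝 0, f (x + s • v) ≤ f x := htend.eventually hmax
    simpa [IsLocalMax, IsMaxFilter] using this
  have hmin : IsLocalMin (fun s : ℝ => f (x + s • v)) 0 :=
    isLocalMin_of_deriv_deriv_pos (by rw [hd2.deriv]; exact hpos) hmax'.deriv_eq_zero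
      hd.self_of_nhds.continuousAt
  -- A positive second derivative would also make `0` a local minimum, so that the restriction of `f`
  -- to the line would be constant near `0`.
  have hconst : (fun s : ℝ => f (x + s • v)) =ᶠ[𝓝 0] fun _ => f (x + (0 : ℝ) • v) := by
    filter_upwards [hmax', hmin] with s h1 h2 using le_antisymm h1 h2
  have h0 : deriv (deriv fun s : ℝ => f (x + s • v)) 0 = 0 := by
    rw [hconst.deriv.deriv_eq]; simp
  rw [hd2.deriv] at h0
  exact hpos.ne' h0

theorem laplacian_nonpos_of_isLocalMax {f : ℂ → ℝ} {x : ℂ} (hmax : IsLocalMax f x)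
    (hf : ContDiffAt ℝ 2 f x) : Δ f x ≤ 0 := by
  rw [InnerProductSpace.laplacian_eq_iteratedFDeriv_complexPlane]
  exact add_nonpos (iteratedFDeriv_two_nonpos_of_isLocalMax hmax hf _)
    (iteratedFDeriv_two_nonpos_of_isLocalMax hmax hf _)

theorem laplacian_re_sq (t : ℂ) : Δ (fun z : ℂ => z.re ^ 2) t = 2 := by
  have h1 : fderiv ℝ (fun z : ℂ => z.re ^ 2) = fun z => (2 * z.re) • Complex.reCLM := by
    funext z
    have h := (Complex.reCLM.hasFDerivAt (x := z)).pow 2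
    simpa using h.fderiv
  have h2 : HasFDerivAt (fun z : ℂ => (2 * z.re) • Complex.reCLM)
      (((2 : ℝ) • Complex.reCLM).smulRight Complex.reCLM) t :=
    ((Complex.reCLM.hasFDerivAt (x := t)).const_mul 2).smul_const Complex.reCLM
  rw [InnerProductSpace.laplacian_eq_iteratedFDeriv_complexPlane]
  simp [iteratedFDeriv_two_apply, h1, h2.fderiv]

theorem isOpen_puncturedDisk : IsOpen puncturedDisk :=
  (isOpen_lt continuous_const continuous_norm).inter (isOpen_lt continuous_norm continuous_const)

/-- The maximum principle for a bounded subharmonic function on the punctured disk: the puncture is a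
removable part of the boundary. -/
theorem le_of_subharmonic_of_bounded {u : ℂ → ℝ} {B c : ℝ}
    (hcont : ContinuousOn u closedPuncturedDisk)
    (hu : ∀ t ∈ puncturedDisk, ContDiffAt ℝ 2 u t)
    (hΔ : ∀ t ∈ puncturedDisk, 0 ≤ Δ u t)
    (hB : ∀ t ∈ puncturedDisk, u t ≤ B)
    (hc : ∀ t : ℂ, ‖t‖ = 1 → u t ≤ c)
    {t : ℂ} (ht : t ∈ closedPuncturedDisk) : u t ≤ c := by
  -- The term `ε (re t)²` makes the sum strictly subharmonic, which excludes interior maxima.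
  have key : ∀ ε > 0, u t + ε * t.re ^ 2 + ε * Real.log ‖t‖ ≤ c + ε := by
    intro ε hε
    set w : ℂ → ℝ := u + ε • ((fun z : ℂ => z.re ^ 2) + fun z : ℂ => Real.log ‖z‖) with hw
    have hw' : ∀ z, w z = u z + ε * z.re ^ 2 + ε * Real.log ‖z‖ := fun z => by
      simp [hw]; ring
    rw [← hw']
    have hre : ∀ z : ℂ, ‖z‖ ≤ 1 → z.re ^ 2 ≤ 1 := fun z hz => by
      have := (Complex.abs_re_le_norm z).trans hz
      rw [← sq_abs]; exact pow_le_one₀ (abs_nonneg _) this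
    -- On a small enough inner circle the logarithm outweighs the bound `B`.
    obtain ⟨η, hη0, hηt, hηB⟩ : ∃ η : ℝ, 0 < η ∧ η ≤ ‖t‖ ∧
        B + ε + ε * Real.log η ≤ c + ε := by
      have h1 : Tendsto (fun η : ℝ => ε * Real.log η) (𝓝[>] 0) atBot :=
        Real.tendsto_log_nhdsGT_zero.const_mul_atBot hε
      have h2 : ∀ᶠ η : ℝ in 𝓝[>] 0, ε * Real.log η ≤ c - B := h1.eventually_le_atBot _
      have h3 : ∀ᶠ η : ℝ in 𝓝[>] 0, η ∈ Set.Ioo 0 ‖t‖ := Ioo_mem_nhdsGT ht.1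
      obtain ⟨η, h4, h5⟩ := (h2.and h3).exists
      exact ⟨η, h5.1, h5.2.le, by linarith⟩
    set S : Set ℂ := {z | η ≤ ‖z‖ ∧ ‖z‖ ≤ 1} with hS
    have hSsub : S ⊆ closedPuncturedDisk := fun z hz => ⟨hη0.trans_le hz.1, hz.2⟩
    have hScomp : IsCompact S := by
      refine (isCompact_closedBall (0 : ℂ) 1).of_isClosed_subset
        ((isClosed_le continuous_const continuous_norm).inter
          (isClosed_le continuous_norm continuous_const)) fun z hz => by simpa using hz.2
    have hwc : ContinuousOn w S := by
      refine (hcont.mono hSsub).add (ContinuousOn.const_smul (ContinuousOn.add (by fun_prop) ?_) ε)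
      exact ContinuousOn.log continuous_norm.continuousOn fun z hz => (hSsub hz).1.ne'
    obtain ⟨z, hzS, hzmax⟩ := hScomp.exists_isMaxOn ⟨t, hηt, ht.2⟩ hwc
    refine (hzmax ⟨hηt, ht.2⟩ : w t ≤ w z).trans ?_
    rw [hw']
    rcases hzS.2.eq_or_lt with h1 | h1
    · have := hre z hzS.2
      have h2 := hc z h1
      rw [h1, Real.log_one]
      nlinarith
    rcases hzS.1.eq_or_lt with h2 | h2
    · have := hre z hzS.2
      have h3 := hB z ⟨(hSsub hzS).1, h1⟩
      rw [← h2]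
      nlinarith
    exfalso
    have hzU : z ∈ puncturedDisk := ⟨(hSsub hzS).1, h1⟩
    have hloc : IsLocalMax w z := by
      refine hzmax.isLocalMax ?_
      filter_upwards [(isOpen_lt continuous_const continuous_norm).mem_nhds h2,
        (isOpen_lt continuous_norm continuous_const).mem_nhds h1] with y hy1 hy2
      exact ⟨le_of_lt hy1, le_of_lt hy2⟩
    have hlog : InnerProductSpace.HarmonicAt (fun z : ℂ => Real.log ‖z‖) z :=
      AnalyticAt.harmonicAt_log_norm (f := fun z : ℂ => z) analyticAt_id (norm_pos_iff.1 hzU.1)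
    have hsq : ContDiffAt ℝ 2 (fun z : ℂ => z.re ^ 2) z :=
      (Complex.reCLM.contDiff.pow 2).contDiffAt
    have hsum : ContDiffAt ℝ 2 ((fun z : ℂ => z.re ^ 2) + fun z : ℂ => Real.log ‖z‖) z :=
      hsq.add hlog.1
    have h5 : Δ w z = Δ u z + 2 * ε := by
      rw [hw, (hu z hzU).laplacian_add (f₂ := ε • ((fun z : ℂ => z.re ^ 2) + fun z : ℂ => Real.log ‖z‖))
        (hsum.const_smul ε),
        InnerProductSpace.laplacian_smul ε hsum, hsq.laplacian_add hlog.1, laplacian_re_sq,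
        hlog.2.self_of_nhds]
      simp [mul_comm]
    have h6 := laplacian_nonpos_of_isLocalMax hloc ((hu z hzU).add (hsum.const_smul ε))
    rw [h5] at h6
    linarith [hΔ z hzU]
  have hlim : Tendsto (fun ε : ℝ => u t + ε * t.re ^ 2 + ε * Real.log ‖t‖) (𝓝[>] 0) (𝓝 (u t)) := by
    have : Continuous (fun ε : ℝ => u t + ε * t.re ^ 2 + ε * Real.log ‖t‖) := by fun_prop
    simpa using (this.tendsto 0).mono_left nhdsWithin_le_nhds
  have hlim' : Tendsto (fun ε : ℝ => c + ε) (𝓝[>] 0) (𝓝 c) := by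
    have : Continuous (fun ε : ℝ => c + ε) := by fun_prop
    simpa using (this.tendsto 0).mono_left nhdsWithin_le_nhds
  exact le_of_tendsto_of_tendsto hlim hlim' (eventually_mem_nhdsWithin.mono fun ε hε => key ε hε)

variable {n : ℕ}

/-! ### Directional derivatives of matrix functions -/

/-- The derivative `∂_v A` of a matrix function in the real direction `v`, entry by entry. -/
noncomputable def matrixDir (v : ℂ) (A : ℂ → Matrix (Fin n) (Fin n) ℂ) (t : ℂ) :
    Matrix (Fin n) (Fin n) ℂ :=
  Matrix.of fun i j => fderiv ℝ (fun s => A s i j) t v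

/-- Every entry of `A` is of class `C^k` over `ℝ` at `t`. Working with entries avoids the choice of a
norm on matrices. -/
def EntrywiseContDiffAt (k : ℕ∞) (A : ℂ → Matrix (Fin n) (Fin n) ℂ) (t : ℂ) : Prop :=
  ∀ i j, ContDiffAt ℝ k (fun s => A s i j) t

namespace EntrywiseContDiffAt

variable {k : ℕ∞} {A B : ℂ → Matrix (Fin n) (Fin n) ℂ} {t : ℂ}

theorem of_le {l : ℕ∞} (hA : EntrywiseContDiffAt k A t) (h : l ≤ k) : EntrywiseContDiffAt l A t :=
  fun i j => (hA i j).of_le (by exact_mod_cast h)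

theorem differentiableAt (hA : EntrywiseContDiffAt 1 A t) (i j : Fin n) :
    DifferentiableAt ℝ (fun s => A s i j) t :=
  (hA i j).differentiableAt (by norm_num)

theorem mul (hA : EntrywiseContDiffAt k A t) (hB : EntrywiseContDiffAt k B t) :
    EntrywiseContDiffAt k (fun s => A s * B s) t := fun i j => by
  simp only [Matrix.mul_apply]
  exact ContDiffAt.sum fun l _ => (hA i l).mul (hB l j)

theorem sub (hA : EntrywiseContDiffAt k A t) (hB : EntrywiseContDiffAt k B t) :
    EntrywiseContDiffAt k (fun s => A s - B s) t := fun i j => (hA i j).sub (hB i j)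

theorem const_smul (hA : EntrywiseContDiffAt k A t) (c : ℂ) :
    EntrywiseContDiffAt k (fun s => c • A s) t := fun i j => (hA i j).const_smul c

theorem det (hA : EntrywiseContDiffAt k A t) : ContDiffAt ℝ k (fun s => (A s).det) t := by
  simp only [Matrix.det_apply]
  exact ContDiffAt.sum fun σ _ => (contDiffAt_prod fun i _ => hA _ _).const_smul _

theorem inv (hA : EntrywiseContDiffAt k A t) (hdet : (A t).det ≠ 0) :
    EntrywiseContDiffAt k (fun s => (A s)⁻¹) t := fun i j => by
  simp only [Matrix.inv_def, Ring.inverse_eq_inv', Matrix.smul_apply, smul_eq_mul,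
    Matrix.adjugate_apply]
  refine (hA.det.inv hdet).mul (EntrywiseContDiffAt.det fun i' j' => ?_)
  by_cases h : i' = j
  · subst h
    simpa using contDiffAt_const
  · simpa [Matrix.updateRow_ne h] using hA i' j'

theorem dir (hA : EntrywiseContDiffAt (k + 1) A t) (v : ℂ) :
    EntrywiseContDiffAt k (matrixDir v A) t := fun i j =>
  ((hA i j).fderiv_right (m := k) (by norm_cast)).clm_apply contDiffAt_const

theorem trace (hA : EntrywiseContDiffAt k A t) : ContDiffAt ℝ k (fun s => (A s).trace) t := by
  simp only [Matrix.trace, Matrix.diag]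
  exact ContDiffAt.sum fun i _ => hA i i

protected theorem eventually (hA : EntrywiseContDiffAt k A t) (hk : k ≠ ⊤) :
    ∀ᶠ s in 𝓝 t, EntrywiseContDiffAt k A s := by
  simp only [EntrywiseContDiffAt, eventually_all]
  exact fun i j => (hA i j).eventually (by exact_mod_cast hk)

end EntrywiseContDiffAt

section DirectionalDerivative

variable {A B : ℂ → Matrix (Fin n) (Fin n) ℂ} {t : ℂ} (v : ℂ)

theorem matrixDir_mul (hA : EntrywiseContDiffAt 1 A t) (hB : EntrywiseContDiffAt 1 B t) :
    matrixDir v (fun s => A s * B s) t = matrixDir v A t * B t + A t * matrixDir v B t := by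
  ext i j
  have h : HasFDerivAt (fun s => (A s * B s) i j)
      (∑ l, (A t i l • fderiv ℝ (fun s => B s l j) t + B t l j • fderiv ℝ (fun s => A s i l) t)) t := by
    simp only [Matrix.mul_apply]
    exact HasFDerivAt.fun_sum fun l _ =>
      (hA.differentiableAt i l).hasFDerivAt.mul (hB.differentiableAt l j).hasFDerivAt
  rw [matrixDir, Matrix.of_apply, h.fderiv]
  simp only [matrixDir, Matrix.of_apply, Matrix.add_apply, Matrix.mul_apply,
    ← Finset.sum_add_distrib, sum_apply, add_apply, smul_apply, smul_eq_mul]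
  exact Finset.sum_congr rfl fun l _ => by ring

theorem matrixDir_sub (hA : EntrywiseContDiffAt 1 A t) (hB : EntrywiseContDiffAt 1 B t) :
    matrixDir v (fun s => A s - B s) t = matrixDir v A t - matrixDir v B t := by
  ext i j
  simp only [matrixDir, Matrix.of_apply, Matrix.sub_apply,
    fderiv_fun_sub (hA.differentiableAt i j) (hB.differentiableAt i j),
    sub_apply]

theorem matrixDir_const_smul (hA : EntrywiseContDiffAt 1 A t) (c : ℂ) :
    matrixDir v (fun s => c • A s) t = c • matrixDir v A t := by
  ext i j
  simp only [matrixDir, Matrix.of_apply, Matrix.smul_apply,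
    fderiv_fun_const_smul (hA.differentiableAt i j), smul_apply]

theorem matrixDir_congr (h : A =ᶠ[𝓝 t] B) : matrixDir v A t = matrixDir v B t := by
  ext i j
  have : (fun s => A s i j) =ᶠ[𝓝 t] fun s => B s i j := h.mono fun s hs => by simp only [hs]
  simp only [matrixDir, Matrix.of_apply, this.fderiv_eq]

/-- Obtained by differentiating `A⁻¹ A = 1`. -/
theorem matrixDir_inv (hA : EntrywiseContDiffAt 1 A t) (hdet : (A t).det ≠ 0) :
    matrixDir v (fun s => (A s)⁻¹) t = -((A t)⁻¹ * matrixDir v A t * (A t)⁻¹) := by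
  have hunit : IsUnit (A t).det := hdet.isUnit
  have h1 : (fun s => (A s)⁻¹ * A s) =ᶠ[𝓝 t] fun _ => 1 :=
    (hA.det.continuousAt.eventually_ne hdet).mono fun s hs => Matrix.nonsing_inv_mul _ hs.isUnit
  have h2 := matrixDir_congr v h1
  rw [matrixDir_mul v (hA.inv hdet) hA] at h2
  have h3 : matrixDir v (fun _ : ℂ => (1 : Matrix (Fin n) (Fin n) ℂ)) t = 0 := by
    ext i j
    simp [matrixDir]
  rw [h3] at h2
  have h4 := congrArg (· * (A t)⁻¹) (eq_neg_of_add_eq_zero_left h2)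
  simpa [Matrix.mul_assoc, Matrix.mul_nonsing_inv _ hunit] using h4

theorem fderiv_re_trace (hA : EntrywiseContDiffAt 1 A t) :
    fderiv ℝ (fun s => (A s).trace.re) t v = (matrixDir v A t).trace.re := by
  have h : HasFDerivAt (fun s => (A s).trace) (∑ i, fderiv ℝ (fun s => A s i i) t) t := by
    simp only [Matrix.trace, Matrix.diag]
    exact HasFDerivAt.fun_sum fun i _ => (hA.differentiableAt i i).hasFDerivAt
  have h' := (Complex.reCLM.hasFDerivAt (x := (A t).trace)).comp t h
  have h'' : fderiv ℝ (fun s => (A s).trace.re) t = _ := h'.fderiv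
  rw [h'']
  simp [matrixDir, Matrix.trace]

theorem matrixDir_matrixDir_comm (hA : EntrywiseContDiffAt 2 A t) (w : ℂ) :
    matrixDir v (matrixDir w A) t = matrixDir w (matrixDir v A) t := by
  ext i j
  have h1 : DifferentiableAt ℝ (fderiv ℝ fun s => A s i j) t :=
    ((hA i j).fderiv_right (m := 1) (by norm_num)).differentiableAt (by norm_num)
  have h2 : ∀ a b : ℂ, fderiv ℝ (fun s => fderiv ℝ (fun s => A s i j) s a) t b =
      fderiv ℝ (fderiv ℝ fun s => A s i j) t b a := fun a b => by
    have := h1.hasFDerivAt.clm_apply (hasFDerivAt_const a t)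
    rw [this.fderiv]
    simp
  simp only [matrixDir, Matrix.of_apply, h2]
  exact ((hA i j).isSymmSndFDerivAt (by simp)).eq v w

end DirectionalDerivative

/-! ### The harmonic metric equation in real coordinates -/

/-- The equation `ΔG = ∂ₓG G⁻¹ ∂ₓG + ∂ᵧG G⁻¹ ∂ᵧG` of a harmonic map into the space of positive
definite matrices, at the point `t`. -/
def HarmonicEquationAt (G : ℂ → Matrix (Fin n) (Fin n) ℂ) (t : ℂ) : Prop :=
  matrixDir 1 (matrixDir 1 G) t + matrixDir Complex.I (matrixDir Complex.I G) t =
    matrixDir 1 G t * (G t)⁻¹ * matrixDir 1 G t +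
      matrixDir Complex.I G t * (G t)⁻¹ * matrixDir Complex.I G t

theorem matrixD_eq (A : ℂ → Matrix (Fin n) (Fin n) ℂ) (t : ℂ) :
    matrixD A t = (1 / 2 : ℂ) • (matrixDir 1 A t - Complex.I • matrixDir Complex.I A t) := by
  ext i j
  simp [matrixD, wirtinger, matrixDir]
  ring

theorem matrixDBar_eq (A : ℂ → Matrix (Fin n) (Fin n) ℂ) (t : ℂ) :
    matrixDBar A t = (1 / 2 : ℂ) • (matrixDir 1 A t + Complex.I • matrixDir Complex.I A t) := by
  ext i j
  simp [matrixDBar, wirtingerBar, matrixDir]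
  ring

/-- Expanding the pseudo-curvature and using `∂ₓ∂ᵧG = ∂ᵧ∂ₓG` gives
`-8 G G_K = ΔG - ∂ₓG G⁻¹ ∂ₓG - ∂ᵧG G⁻¹ ∂ᵧG`. -/
theorem harmonicEquationAt_of_lambdaPseudoCurvature_eq_zero
    {G : ℂ → Matrix (Fin n) (Fin n) ℂ} {t : ℂ} (hG : EntrywiseContDiffAt 2 G t)
    (hdet : (G t).det ≠ 0) (h : lambdaPseudoCurvature G t = 0) : HarmonicEquationAt G t := by
  have hunit : IsUnit (G t).det := hdet.isUnit
  have hG1 := hG.of_le (l := 1) (by norm_num)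
  have hGd : ∀ v, EntrywiseContDiffAt 1 (matrixDir v G) t := fun v => hG.dir v
  have hD : EntrywiseContDiffAt 1
      (fun s => matrixDir 1 G s - Complex.I • matrixDir Complex.I G s) t :=
    (hGd 1).sub ((hGd Complex.I).const_smul _)
  have htheta : theta G = fun s => (-1 / 4 : ℂ) •
      ((G s)⁻¹ * (matrixDir 1 G s - Complex.I • matrixDir Complex.I G s)) := by
    funext s
    rw [theta, matrixD_eq, Matrix.mul_smul, smul_smul]
    norm_num
  have hdtheta : ∀ v, matrixDir v (theta G) t = (-1 / 4 : ℂ) •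
      (-((G t)⁻¹ * matrixDir v G t * (G t)⁻¹) *
          (matrixDir 1 G t - Complex.I • matrixDir Complex.I G t) +
        (G t)⁻¹ * (matrixDir v (matrixDir 1 G) t -
          Complex.I • matrixDir v (matrixDir Complex.I G) t)) := fun v => by
    rw [htheta, matrixDir_const_smul v ((hG1.inv hdet).mul hD),
      matrixDir_mul v (hG1.inv hdet) hD, matrixDir_inv v hG1 hdet,
      matrixDir_sub v (hGd 1) ((hGd _).const_smul _), matrixDir_const_smul v (hGd _)]
  have h0 : pseudoCurvature G t = 0 :=
    (smul_eq_zero_iff_right Complex.I_ne_zero).1 h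
  have hcomm := matrixDir_matrixDir_comm 1 hG Complex.I
  rw [pseudoCurvature, matrixDBar_eq, hdtheta, hdtheta, htheta, thetaBar, matrixDBar_eq, hcomm] at h0
  have h1 := congrArg (fun M => (-8 : ℂ) • (G t * M)) h0
  have hcancel : ∀ M, G t * ((G t)⁻¹ * M) = M := fun M =>
    Matrix.mul_nonsing_inv_cancel_left _ M hunit
  rw [HarmonicEquationAt, ← sub_eq_zero]
  simp only [Matrix.mul_add, Matrix.mul_sub, Matrix.add_mul, Matrix.sub_mul, Matrix.mul_smul,
    Matrix.smul_mul, Matrix.mul_assoc, Matrix.neg_mul, Matrix.mul_neg, hcancel, smul_add, smul_sub,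
    smul_neg, smul_smul, Matrix.mul_zero, smul_zero] at h1 ⊢
  rw [← h1]
  match_scalars <;> grind [Complex.I_sq]

/-! ### Traces of products of positive matrices -/

section PositiveMatrices

open scoped MatrixOrder ComplexOrder

variable {P Q M G H : Matrix (Fin n) (Fin n) ℂ}

theorem re_trace_mul_nonneg (hP : P.PosSemidef) (hM : M.PosSemidef) :
    0 ≤ (P * M).trace.re := by
  obtain ⟨B, rfl⟩ := CStarAlgebra.nonneg_iff_eq_star_mul_self.mp hP.nonneg
  rw [Matrix.mul_assoc, Matrix.trace_mul_comm]
  exact (Complex.nonneg_iff.1 (hM.mul_mul_conjTranspose_same B).trace_nonneg).1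

theorem re_trace_mul_mul_mul_nonneg (hP : P.PosSemidef) (hQ : Q.PosSemidef)
    (M : Matrix (Fin n) (Fin n) ℂ) : 0 ≤ (P * (M * Q * Mᴴ)).trace.re :=
  re_trace_mul_nonneg hP (hQ.mul_mul_conjTranspose_same M)

theorem eq_zero_of_re_trace_mul_eq_zero (hP : P.PosDef) (hM : M.PosSemidef)
    (h : (P * M).trace.re ≤ 0) : M = 0 := by
  obtain ⟨B, rfl⟩ := CStarAlgebra.nonneg_iff_eq_star_mul_self.mp hP.posSemidef.nonneg
  have hB : IsUnit B := by
    have := hP.isUnit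
    rw [Matrix.isUnit_iff_isUnit_det, Matrix.det_mul] at this
    exact (Matrix.isUnit_iff_isUnit_det _).2 (isUnit_of_mul_isUnit_right this)
  have hpsd := hM.mul_mul_conjTranspose_same B
  rw [Matrix.mul_assoc, Matrix.trace_mul_comm] at h
  have h0 : (B * M * Bᴴ).trace = 0 := by
    have h1 := Complex.nonneg_iff.1 hpsd.trace_nonneg
    exact Complex.ext (le_antisymm h h1.1) h1.2.symm
  have h2 := hpsd.trace_eq_zero_iff.1 h0
  have hB' : IsUnit Bᴴ := hB.star
  exact hB.mul_left_cancel (hB'.mul_right_cancel (by simpa using h2))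

/-- Equality holds in `tr(G⁻¹H) + tr(H⁻¹G) ≥ 2n` only for `G = H`. -/
theorem eq_of_re_trace_inv_mul_le (hG : G.PosDef) (hH : H.PosDef)
    (h1 : (G⁻¹ * H).trace.re ≤ n) (h2 : (H⁻¹ * G).trace.re ≤ n) : G = H := by
  have hGu : IsUnit G.det := (Matrix.isUnit_iff_isUnit_det _).1 hG.isUnit
  have hHu : IsUnit H.det := (Matrix.isUnit_iff_isUnit_det _).1 hH.isUnit
  have hsa : (H - G)ᴴ = H - G := by
    rw [Matrix.conjTranspose_sub, hG.isHermitian.eq, hH.isHermitian.eq]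
  have hpsd : ((H - G) * H⁻¹ * (H - G)).PosSemidef := by
    simpa only [hsa] using hH.inv.posSemidef.mul_mul_conjTranspose_same (H - G)
  have hid : G⁻¹ * ((H - G) * H⁻¹ * (H - G)) = G⁻¹ * H - 1 - (1 - H⁻¹ * G) := by
    simp only [Matrix.sub_mul, Matrix.mul_sub, Matrix.mul_nonsing_inv _ hHu, Matrix.one_mul,
      Matrix.nonsing_inv_mul_cancel_left _ _ hGu, Matrix.mul_assoc, Matrix.nonsing_inv_mul _ hHu,
      Matrix.nonsing_inv_mul _ hGu, Matrix.mul_one]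
  have h0 := eq_zero_of_re_trace_mul_eq_zero hG.inv hpsd (by
    rw [hid]
    simp
    linarith)
  -- With `X = H - G`, the vanishing of `X H⁻¹ X` gives that of `tr(H⁻¹ X Xᴴ)`.
  have h3 := eq_zero_of_re_trace_mul_eq_zero hH.inv (M := (H - G) * (H - G)ᴴ)
    (Matrix.posSemidef_self_mul_conjTranspose _) (by
      rw [hsa, ← Matrix.mul_assoc, Matrix.trace_mul_comm, ← Matrix.mul_assoc, h0]; simp)
  exact (sub_eq_zero.1 (Matrix.self_mul_conjTranspose_eq_zero.1 h3)).symm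

theorem re_trace_inv_mul_le {a : ℝ} (hG : G.PosDef) (h : ((a : ℂ) • G - H).PosSemidef) :
    (G⁻¹ * H).trace.re ≤ a * n := by
  have hGu : IsUnit G.det := (Matrix.isUnit_iff_isUnit_det _).1 hG.isUnit
  have := re_trace_mul_nonneg hG.inv.posSemidef h
  rw [Matrix.mul_sub, Matrix.mul_smul, Matrix.nonsing_inv_mul _ hGu] at this
  simpa using this

end PositiveMatrices

/-! ### Subharmonicity of the trace -/

section Subharmonic

open scoped ComplexOrder

variable {G H : ℂ → Matrix (Fin n) (Fin n) ℂ} {t : ℂ}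

theorem conjTranspose_matrixDir (hG : EntrywiseContDiffAt 1 G t)
    (hherm : ∀ᶠ s in 𝓝 t, (G s).IsHermitian) (v : ℂ) :
    (matrixDir v G t)ᴴ = matrixDir v G t := by
  ext i j
  have h1 : (fun s => G s i j) =ᶠ[𝓝 t] fun s => Complex.conjCLE (G s j i) :=
    hherm.mono fun s hs => (hs.apply i j).symm
  have h2 := Complex.conjCLE.hasFDerivAt.comp t (hG.differentiableAt j i).hasFDerivAt
  rw [Matrix.conjTranspose_apply, matrixDir, Matrix.of_apply, Matrix.of_apply, h1.fderiv_eq]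
  exact (congrArg (fun L => L v) h2.fderiv).symm

theorem iteratedFDeriv_two_re_trace {A : ℂ → Matrix (Fin n) (Fin n) ℂ}
    (hA : EntrywiseContDiffAt 2 A t) (v : ℂ) :
    iteratedFDeriv ℝ 2 (fun s => (A s).trace.re) t ![v, v] =
      (matrixDir v (matrixDir v A) t).trace.re := by
  have hu : ContDiffAt ℝ 2 (fun s => (A s).trace.re) t :=
    Complex.reCLM.contDiff.contDiffAt.comp t hA.trace
  have hd : DifferentiableAt ℝ (fderiv ℝ fun s => (A s).trace.re) t :=
    (hu.fderiv_right (m := 1) (by norm_num)).differentiableAt (by norm_num)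
  have h1 : (fun s => fderiv ℝ (fun s => (A s).trace.re) s v) =ᶠ[𝓝 t]
      fun s => (matrixDir v A s).trace.re :=
    (hA.eventually (by simp)).mono fun s hs => fderiv_re_trace v (hs.of_le (by norm_num))
  have h2 := (hd.hasFDerivAt.clm_apply (hasFDerivAt_const v t)).fderiv
  rw [h1.fderiv_eq] at h2
  have h3 := congrArg (fun L => L v) h2
  simp only [fderiv_re_trace v (hA.dir v)] at h3
  rw [h3, iteratedFDeriv_two_apply]
  simp

theorem laplacian_re_trace {A : ℂ → Matrix (Fin n) (Fin n) ℂ} (hA : EntrywiseContDiffAt 2 A t) :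
    Δ (fun s => (A s).trace.re) t = (matrixDir 1 (matrixDir 1 A) t +
      matrixDir Complex.I (matrixDir Complex.I A) t).trace.re := by
  rw [InnerProductSpace.laplacian_eq_iteratedFDeriv_complexPlane]
  simp only [iteratedFDeriv_two_re_trace hA, Matrix.trace_add, Complex.add_re]

/-- The second derivative of `P H` with `P = G⁻¹`; the mixed terms are grouped so that `P` factors
out on the left. -/
theorem matrixDir_matrixDir_inv_mul (hG : EntrywiseContDiffAt 2 G t)
    (hH : EntrywiseContDiffAt 2 H t) (hdet : (G t).det ≠ 0) (v : ℂ) :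
    matrixDir v (matrixDir v fun s => (G s)⁻¹ * H s) t =
      (G t)⁻¹ * (matrixDir v (matrixDir v H) t - matrixDir v (matrixDir v G) t * (G t)⁻¹ * H t
        + 2 • (matrixDir v G t * (G t)⁻¹ * (matrixDir v G t * (G t)⁻¹ * H t - matrixDir v H t)))
      := by
  have hG1 := hG.of_le (l := 1) (by norm_num)
  have hH1 := hH.of_le (l := 1) (by norm_num)
  have hP := hG1.inv hdet
  have hGv : EntrywiseContDiffAt 1 (matrixDir v G) t := hG.dir v
  have hHv : EntrywiseContDiffAt 1 (matrixDir v H) t := hH.dir v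
  have h1 : (matrixDir v fun s => (G s)⁻¹ * H s) =ᶠ[𝓝 t]
      fun s => (G s)⁻¹ * (matrixDir v H s - matrixDir v G s * ((G s)⁻¹ * H s)) := by
    filter_upwards [hG1.eventually (by simp), hH1.eventually (by simp),
      hG.det.continuousAt.eventually_ne hdet] with s hs hs' hds
    rw [matrixDir_mul v (hs.inv hds) hs', matrixDir_inv v hs hds]
    noncomm_ring
  rw [matrixDir_congr v h1, matrixDir_mul v hP (hHv.sub (hGv.mul (hP.mul hH1))),
    matrixDir_sub v hHv (hGv.mul (hP.mul hH1)), matrixDir_mul v hGv (hP.mul hH1),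
    matrixDir_mul v hP hH1, matrixDir_inv v hG1 hdet]
  noncomm_ring

/-- The trace `tr(G⁻¹H)` is subharmonic for two solutions `G`, `H` of the harmonic equation. -/
theorem laplacian_re_trace_inv_mul_nonneg (hG : EntrywiseContDiffAt 2 G t)
    (hH : EntrywiseContDiffAt 2 H t) (hGpos : ∀ᶠ s in 𝓝 t, (G s).PosDef)
    (hHpos : ∀ᶠ s in 𝓝 t, (H s).PosDef) (hGharm : HarmonicEquationAt G t)
    (hHharm : HarmonicEquationAt H t) : 0 ≤ Δ (fun s => ((G s)⁻¹ * H s).trace.re) t := by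
  have hGt := hGpos.self_of_nhds
  have hHt := hHpos.self_of_nhds
  have hGu : IsUnit (G t).det := (Matrix.isUnit_iff_isUnit_det _).1 hGt.isUnit
  have hHu : IsUnit (H t).det := (Matrix.isUnit_iff_isUnit_det _).1 hHt.isUnit
  have hGh : ∀ v, (matrixDir v G t)ᴴ = matrixDir v G t := conjTranspose_matrixDir
    (hG.of_le (by norm_num)) (hGpos.mono fun s hs => hs.isHermitian)
  have hHh : ∀ v, (matrixDir v H t)ᴴ = matrixDir v H t := conjTranspose_matrixDir
    (hH.of_le (by norm_num)) (hHpos.mono fun s hs => hs.isHermitian)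
  rw [laplacian_re_trace ((hG.inv hGu.ne_zero).mul hH),
    matrixDir_matrixDir_inv_mul hG hH hGu.ne_zero, matrixDir_matrixDir_inv_mul hG hH hGu.ne_zero,
    ← Matrix.mul_add]
  have hsum := fun v => re_trace_mul_mul_mul_nonneg hGt.inv.posSemidef hHt.inv.posSemidef
    (matrixDir v H t - matrixDir v G t * (G t)⁻¹ * H t)
  -- The square of `M = ∂ᵥH - ∂ᵥG G⁻¹ H`, expanded by cyclicity of the trace, is the contribution of
  -- the direction `v` to the Laplacian once the harmonic equations are inserted.
  have hsq : ∀ v, ((G t)⁻¹ * ((matrixDir v H t - matrixDir v G t * (G t)⁻¹ * H t) * (H t)⁻¹ *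
      (matrixDir v H t - matrixDir v G t * (G t)⁻¹ * H t)ᴴ)).trace =
      ((G t)⁻¹ * (matrixDir v H t * (H t)⁻¹ * matrixDir v H t -
        matrixDir v G t * (G t)⁻¹ * matrixDir v G t * (G t)⁻¹ * H t +
        2 • (matrixDir v G t * (G t)⁻¹ *
          (matrixDir v G t * (G t)⁻¹ * H t - matrixDir v H t)))).trace := fun v => by
    have e1 : ((G t)⁻¹ * (matrixDir v H t * ((G t)⁻¹ * matrixDir v G t))).trace =
        ((G t)⁻¹ * (matrixDir v G t * ((G t)⁻¹ * matrixDir v H t))).trace := by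
      rw [← Matrix.mul_assoc, Matrix.trace_mul_comm, Matrix.mul_assoc]
    have e2 : ((G t)⁻¹ * (matrixDir v G t * ((G t)⁻¹ * (H t * ((G t)⁻¹ * matrixDir v G t))))).trace
        = ((G t)⁻¹ * (matrixDir v G t * ((G t)⁻¹ * (matrixDir v G t * ((G t)⁻¹ * H t))))).trace := by
      rw [← Matrix.mul_assoc, ← Matrix.mul_assoc, ← Matrix.mul_assoc, Matrix.trace_mul_comm]
      simp only [Matrix.mul_assoc]
    simp only [Matrix.conjTranspose_sub, Matrix.conjTranspose_mul, hGh, hHh,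
      hGt.isHermitian.inv.eq, hHt.isHermitian.eq, Matrix.sub_mul, Matrix.mul_sub, Matrix.mul_add,
      Matrix.mul_assoc, Matrix.mul_nonsing_inv_cancel_left _ _ hHu,
      Matrix.nonsing_inv_mul_cancel_left _ _ hHu, two_smul,
      Matrix.trace_add, Matrix.trace_sub, e1, e2]
    ring
  have h1 := hsum 1
  have h2 := hsum Complex.I
  rw [hsq] at h1 h2
  rw [HarmonicEquationAt] at hGharm hHharm
  have := add_nonneg h1 h2
  rw [← Complex.add_re, ← Matrix.trace_add, ← Matrix.mul_add] at this
  have e : ∀ a b c d e f p h : Matrix (Fin n) (Fin n) ℂ, a - c * p * h + e + (b - d * p * h + f) =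
      (a + b) - (c + d) * p * h + (e + f) := by intros; noncomm_ring
  rw [e] at this ⊢
  rwa [hGharm, hHharm]

theorem re_trace_inv_mul_le_on_closedPuncturedDisk {G H : ℂ → Matrix (Fin n) (Fin n) ℂ} {B : ℝ}
    (hGc : ContinuousOn G closedPuncturedDisk) (hHc : ContinuousOn H closedPuncturedDisk)
    (hGpos : ∀ t ∈ closedPuncturedDisk, (G t).PosDef)
    (hHpos : ∀ t ∈ closedPuncturedDisk, (H t).PosDef)
    (hG : ∀ t ∈ puncturedDisk, EntrywiseContDiffAt 2 G t)
    (hH : ∀ t ∈ puncturedDisk, EntrywiseContDiffAt 2 H t)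
    (hGharm : ∀ t ∈ puncturedDisk, lambdaPseudoCurvature G t = 0)
    (hHharm : ∀ t ∈ puncturedDisk, lambdaPseudoCurvature H t = 0)
    (hbdry : ∀ t : ℂ, ‖t‖ = 1 → G t = H t)
    (hB : ∀ t ∈ puncturedDisk, ((G t)⁻¹ * H t).trace.re ≤ B)
    {t : ℂ} (ht : t ∈ closedPuncturedDisk) : ((G t)⁻¹ * H t).trace.re ≤ n := by
  have hsub : puncturedDisk ⊆ closedPuncturedDisk := fun t ht => ⟨ht.1, ht.2.le⟩
  have hGdet : ∀ t ∈ closedPuncturedDisk, (G t).det ≠ 0 := fun t ht =>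
    ((Matrix.isUnit_iff_isUnit_det _).1 (hGpos t ht).isUnit).ne_zero
  have hHdet : ∀ t ∈ closedPuncturedDisk, (H t).det ≠ 0 := fun t ht =>
    ((Matrix.isUnit_iff_isUnit_det _).1 (hHpos t ht).isUnit).ne_zero
  refine le_of_subharmonic_of_bounded (u := fun t => ((G t)⁻¹ * H t).trace.re) ?_ ?_ ?_ hB ?_ ht
  · have hinv : ContinuousOn (fun t => (G t)⁻¹) closedPuncturedDisk := by
      simp only [Matrix.inv_def, Ring.inverse_eq_inv']
      exact ((continuous_id.matrix_det.comp_continuousOn hGc).inv₀ hGdet).smul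
        (continuous_id.matrix_adjugate.comp_continuousOn hGc)
    exact Complex.continuous_re.comp_continuousOn
      (continuous_id.matrix_trace.comp_continuousOn (hinv.mul hHc))
  · exact fun t ht => Complex.reCLM.contDiff.contDiffAt.comp t
      (((hG t ht).inv (hGdet t (hsub ht))).mul (hH t ht)).trace
  · intro t ht
    have hev := isOpen_puncturedDisk.mem_nhds ht
    exact laplacian_re_trace_inv_mul_nonneg (hG t ht) (hH t ht)
      (mem_of_superset hev fun s hs => hGpos s (hsub hs))
      (mem_of_superset hev fun s hs => hHpos s (hsub hs))
      (harmonicEquationAt_of_lambdaPseudoCurvature_eq_zero (hG t ht) (hGdet t (hsub ht))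
        (hGharm t ht))
      (harmonicEquationAt_of_lambdaPseudoCurvature_eq_zero (hH t ht) (hHdet t (hsub ht))
        (hHharm t ht))
  · intro t ht
    have ht' : t ∈ closedPuncturedDisk := ⟨by rw [ht]; exact one_pos, ht.le⟩
    simp [← hbdry t ht, Matrix.nonsing_inv_mul _ (hGdet t ht').isUnit]

end Subharmonic

/-! ### Inner product cores on a complex vector space -/

section Cores

variable {V : Type*} [AddCommGroup V] [Module ℂ V]

/-- Bounds on the eigenvalues of `h` in `K = h K₀` are bounds between the quadratic forms, since `h`
is diagonal in a `K₀`-orthonormal basis. -/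
theorem mul_inner_self_le_of_hasEigenvalue [FiniteDimensional ℂ V]
    (K K₀ : InnerProductSpace.Core ℂ V) {c C : ℝ} {h : Module.End ℂ V}
    (hK : ∀ u v, K.inner v u = K₀.inner v (h u))
    (hev : ∀ μ : ℂ, h.HasEigenvalue μ → c ≤ ‖μ‖ ∧ ‖μ‖ ≤ C) (u : V) :
    c * (K₀.inner u u).re ≤ (K.inner u u).re ∧ (K.inner u u).re ≤ C * (K₀.inner u u).re := by
  let _ : NormedAddCommGroup V := @InnerProductSpace.Core.toNormedAddCommGroup ℂ V _ _ _ K₀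
  let _ : InnerProductSpace ℂ V := InnerProductSpace.ofCore K₀.toCore
  have hin : ∀ x y : V, K₀.inner x y = inner ℂ x y := fun _ _ => rfl
  have hsymm : h.IsSymmetric := fun x y => by
    rw [← hin, ← hin, ← hK, ← K₀.conj_inner_symm, ← hK, K.conj_inner_symm]
  set b := hsymm.eigenvectorBasis rfl
  set l := hsymm.eigenvalues rfl
  have hb : ∀ i, h (b i) = (l i : ℂ) • b i := fun i => hsymm.apply_eigenvectorBasis rfl i
  have hl : ∀ i, c ≤ l i ∧ l i ≤ C := fun i => by
    have h1 := hev _ (hsymm.hasEigenvalue_eigenvalues rfl i)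
    -- The bounds are on `‖μ‖`; positivity of `K` gives the sign of `μ`.
    have h2 : 0 ≤ l i := by
      have h3 : 0 ≤ (K.inner (b i) (b i)).re := K.re_inner_nonneg (b i)
      rw [hK, hin, hb, inner_smul_right, inner_self_eq_norm_sq_to_K, b.orthonormal.1] at h3
      simpa using h3
    have h4 : ‖((l i : ℝ) : ℂ)‖ = l i := by simp [abs_of_nonneg h2]
    exact ⟨h1.1.trans_eq h4, h4.symm.trans_le h1.2⟩
  have e0 : (K₀.inner u u).re = ∑ i, ‖inner ℂ (b i) u‖ ^ 2 := by
    have := b.sum_sq_norm_inner_right u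
    rw [this, hin]
    exact inner_self_eq_norm_sq (𝕜 := ℂ) u
  have e1 : (K.inner u u).re = ∑ i, l i * ‖inner ℂ (b i) u‖ ^ 2 := by
    rw [hK, hin, ← b.sum_inner_mul_inner, Complex.re_sum]
    refine Finset.sum_congr rfl fun i _ => ?_
    rw [← hsymm, hb, inner_smul_left, ← inner_conj_symm u (b i), mul_left_comm, mul_comm _ (inner ℂ (b i) u),
      Complex.mul_conj, Complex.normSq_eq_norm_sq]
    rw [Complex.conj_ofReal, Complex.re_ofReal_mul, Complex.ofReal_re]
  rw [e0, e1, Finset.mul_sum, Finset.mul_sum]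
  exact ⟨Finset.sum_le_sum fun i _ => mul_le_mul_of_nonneg_right (hl i).1 (by positivity),
    Finset.sum_le_sum fun i _ => mul_le_mul_of_nonneg_right (hl i).2 (by positivity)⟩

theorem core_inner_sum_sum (K : InnerProductSpace.Core ℂ V) {ι : Type*} [Fintype ι] (v : ι → V)
    (x y : ι → ℂ) : K.inner (∑ i, x i • v i) (∑ j, y j • v j) =
      star x ⬝ᵥ (Matrix.of fun i j => K.inner (v i) (v j)) *ᵥ y := by
  let _ : NormedAddCommGroup V := @InnerProductSpace.Core.toNormedAddCommGroup ℂ V _ _ _ K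
  let _ : InnerProductSpace ℂ V := InnerProductSpace.ofCore K.toCore
  have hin : ∀ x y : V, K.inner x y = inner ℂ x y := fun _ _ => rfl
  simp only [hin, sum_inner, inner_sum, inner_smul_left, inner_smul_right, dotProduct,
    Matrix.mulVec, Matrix.of_apply, Finset.mul_sum, Pi.star_apply, RCLike.star_def]
  rw [Finset.sum_comm]
  exact Finset.sum_congr rfl fun i _ => Finset.sum_congr rfl fun j _ => by ring

theorem core_ext {K K' : InnerProductSpace.Core ℂ V} (h : ∀ x y, K.inner x y = K'.inner x y) :
    K = K' := by
  obtain ⟨⟨⟨i⟩, _, _, _, _⟩, _⟩ := K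
  obtain ⟨⟨⟨i'⟩, _, _, _, _⟩, _⟩ := K'
  obtain rfl : i = i' := funext fun x => funext fun y => h x y
  rfl

open scoped ComplexOrder in
theorem posDef_coreGram (K : InnerProductSpace.Core ℂ V) {n : ℕ} (b : Module.Basis (Fin n) ℂ V) :
    (Matrix.of fun i j => K.inner (b i) (b j)).PosDef := by
  let _ : NormedAddCommGroup V := @InnerProductSpace.Core.toNormedAddCommGroup ℂ V _ _ _ K
  let _ : InnerProductSpace ℂ V := InnerProductSpace.ofCore K.toCore
  exact Matrix.posDef_gram_of_linearIndependent b.linearIndependent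

end Cores

/-! ### The fibres of the flat bundle -/

section Fibers

variable {X : Type*} [TopologicalSpace X] {x₀ : X} {n : ℕ}
  (ρ : FundamentalGroup X x₀ →* GL (Fin n) ℂ)

theorem flatVector_apply_self {x : X} (γ : Path.Homotopic.Quotient x x₀) (w : Fin n → ℂ) :
    (flatVector ρ γ w).1 γ = w := by
  have h : FundamentalGroup.fromPath (γ.symm.trans γ) = 1 := by
    rw [Path.Homotopic.Quotient.symm_trans]; rfl
  simp only [flatVector, h, map_one, Units.val_one, Matrix.one_mulVec]

/-- By equivariance, a vector of `L_ρ` is determined by its value at one point `γ` of the universal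
covering. -/
theorem eq_flatVector {x : X} (γ : Path.Homotopic.Quotient x x₀) (s : Fiber ρ x) :
    flatVector ρ γ (s.1 γ) = s := by
  refine Subtype.ext (funext fun γ' => ?_)
  have h := s.2 (FundamentalGroup.fromPath (γ.symm.trans γ')) γ
  have h' : γ.trans (FundamentalGroup.fromPath (γ.symm.trans γ')).toPath = γ' := by
    change γ.trans (γ.symm.trans γ') = γ'
    rw [← Path.Homotopic.Quotient.trans_assoc, Path.Homotopic.Quotient.trans_symm,
      Path.Homotopic.Quotient.refl_trans]
  rw [h'] at h
  exact h.symm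

/-- Evaluation at the point `γ` of the universal covering, an isomorphism of the fibre with `ℂⁿ`. -/
noncomputable def fiberEquiv {x : X} (γ : Path.Homotopic.Quotient x x₀) :
    Fiber ρ x ≃ₗ[ℂ] (Fin n → ℂ) where
  toFun s := s.1 γ
  map_add' _ _ := rfl
  map_smul' _ _ := rfl
  invFun := flatVector ρ γ
  left_inv := eq_flatVector ρ γ
  right_inv := flatVector_apply_self ρ γ

/-- The basis of the fibre that corresponds to the standard basis of `ℂⁿ` under evaluation at `γ`. -/
noncomputable def fiberBasis {x : X} (γ : Path.Homotopic.Quotient x x₀) :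
    Module.Basis (Fin n) ℂ (Fiber ρ x) :=
  Module.Basis.ofEquivFun (fiberEquiv ρ γ)

theorem fiberBasis_apply {x : X} (γ : Path.Homotopic.Quotient x x₀) (i : Fin n) :
    fiberBasis ρ γ i = flatVector ρ γ (Pi.single i 1) := by
  simp [fiberBasis, fiberEquiv]

end Fibers

/-! ### Gram matrices over a coordinate disk -/

namespace CoordinateDisk

variable {X : Type*} [TopologicalSpace X] [ChartedSpace ℂ X] {D : CoordinateDisk X}
  {x₀ : X} {n : ℕ} {ρ : FundamentalGroup X x₀ →* GL (Fin n) ℂ}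
  {γ : Path.Homotopic.Quotient D.center x₀}
  {K K₀ K' : HermitianMetric ρ D.closedPunctured}

/-- The flat frame at the point with coordinate `t`, as a basis of the fibre. -/
noncomputable def frameBasis (ρ : FundamentalGroup X x₀ →* GL (Fin n) ℂ)
    (γ : Path.Homotopic.Quotient D.center x₀) {t : ℂ} (ht : t ∈ closedPuncturedDisk) :
    Module.Basis (Fin n) ℂ (Fiber ρ (D.point t)) :=
  fiberBasis ρ ((Path.Homotopic.Quotient.mk (D.radialPath ht)).trans γ)

theorem gram_eq (K : HermitianMetric ρ D.closedPunctured) {t : ℂ} (ht : t ∈ closedPuncturedDisk) :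
    D.gram K γ t = Matrix.of fun i j => (K ⟨D.point t, D.point_mem ht⟩).inner
      (frameBasis ρ γ ht i) (frameBasis ρ γ ht j) := by
  simp only [gram, dif_pos ht, frameBasis, fiberBasis_apply, flatFrame]

open scoped ComplexOrder in
theorem posDef_gram (K : HermitianMetric ρ D.closedPunctured) {t : ℂ}
    (ht : t ∈ closedPuncturedDisk) : (D.gram K γ t).PosDef := by
  rw [gram_eq K ht]
  exact posDef_coreGram _ _

theorem core_eq_of_gram_eq {t : ℂ} (ht : t ∈ closedPuncturedDisk)
    (h : D.gram K γ t = D.gram K' γ t) :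
    K ⟨D.point t, D.point_mem ht⟩ = K' ⟨D.point t, D.point_mem ht⟩ := by
  rw [gram_eq K ht, gram_eq K' ht] at h
  refine core_ext fun x y => ?_
  rw [← (frameBasis ρ γ ht).sum_repr x, ← (frameBasis ρ γ ht).sum_repr y, core_inner_sum_sum,
    core_inner_sum_sum, h]

theorem star_dotProduct_gram_mulVec {t : ℂ} (ht : t ∈ closedPuncturedDisk) (x : Fin n → ℂ) :
    star x ⬝ᵥ D.gram K γ t *ᵥ x = (K ⟨D.point t, D.point_mem ht⟩).inner
      (∑ i, x i • frameBasis ρ γ ht i) (∑ i, x i • frameBasis ρ γ ht i) := by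
  rw [gram_eq K ht]
  exact (core_inner_sum_sum _ _ _ _).symm

theorem point_mem_punctured {t : ℂ} (ht : t ∈ puncturedDisk) : D.point t ∈ D.punctured := by
  have h := D.mem_target (t := t) ⟨ht.1, ht.2.le⟩
  exact ⟨D.chart.map_target h, by simpa only [point, D.chart.right_inv h] using ht⟩

open scoped ComplexOrder in
/-- Two metrics that are mutually bounded with `K₀` satisfy `K' ≤ a K` for a constant `a`. -/
theorem exists_posSemidef_smul_gram_sub_gram (hK : MutuallyBoundedOn K K₀ D.punctured)
    (hK' : MutuallyBoundedOn K' K₀ D.punctured) (γ : Path.Homotopic.Quotient D.center x₀) :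
    ∃ a : ℝ, ∀ t ∈ puncturedDisk, ((a : ℂ) • D.gram K γ t - D.gram K' γ t).PosSemidef := by
  obtain ⟨c, C, hc, hb⟩ := hK
  obtain ⟨c', C', hc', hb'⟩ := hK'
  -- `C'` is nonnegative unless the fibre is zero; the absolute value covers that case.
  refine ⟨|C'| / c, fun t ht => ?_⟩
  have ht' : t ∈ closedPuncturedDisk := ⟨ht.1, ht.2.le⟩
  have : FiniteDimensional ℂ (Fiber ρ (D.point t)) := (frameBasis ρ γ ht').finiteDimensional_of_finite
  obtain ⟨h, hh, hev⟩ := hb ⟨D.point t, D.point_mem ht'⟩ (point_mem_punctured ht)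
  obtain ⟨h', hh', hev'⟩ := hb' ⟨D.point t, D.point_mem ht'⟩ (point_mem_punctured ht)
  have hherm := (posDef_gram (γ := γ) K ht').isHermitian
  have hherm' := (posDef_gram (γ := γ) K' ht').isHermitian
  refine Matrix.PosSemidef.of_dotProduct_mulVec_nonneg ?_ fun x => ?_
  · refine Matrix.IsHermitian.sub ?_ hherm'
    rw [Matrix.IsHermitian, Matrix.conjTranspose_smul, hherm.eq]
    simp
  · rw [Matrix.sub_mulVec, Matrix.smul_mulVec, dotProduct_sub, dotProduct_smul]
    have him := (posDef_gram (γ := γ) K ht').posSemidef.dotProduct_mulVec_nonneg x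
    have him' := (posDef_gram (γ := γ) K' ht').posSemidef.dotProduct_mulVec_nonneg x
    rw [Complex.nonneg_iff] at him him' ⊢
    refine ⟨?_, by simp [← him.2, ← him'.2]⟩
    have h1 := (mul_inner_self_le_of_hasEigenvalue _ _ hh hev
      (∑ i, x i • frameBasis ρ γ ht' i)).1
    have h2 := (mul_inner_self_le_of_hasEigenvalue _ _ hh' hev'
      (∑ i, x i • frameBasis ρ γ ht' i)).2
    rw [← star_dotProduct_gram_mulVec, ← star_dotProduct_gram_mulVec] at h1 h2
    have h0 := ((posDef_gram (γ := γ) K₀ ht').posSemidef.re_dotProduct_nonneg x)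
    simp only [smul_eq_mul, Complex.sub_re, Complex.re_ofReal_mul, sub_nonneg]
    calc _ ≤ _ := h2
      _ ≤ |C'| * (star x ⬝ᵥ D.gram K₀ γ t *ᵥ x).re := mul_le_mul_of_nonneg_right (le_abs_self _) h0
      _ = |C'| / c * (c * (star x ⬝ᵥ D.gram K₀ γ t *ᵥ x).re) := by field_simp
      _ ≤ _ := mul_le_mul_of_nonneg_left h1 (by positivity)

theorem IsHarmonicMetric.entrywiseContDiffAt (h : D.IsHarmonicMetric K)
    (γ : Path.Homotopic.Quotient D.center x₀) {t : ℂ} (ht : t ∈ puncturedDisk) :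
    EntrywiseContDiffAt 2 (D.gram K γ) t := fun i j =>
  ((h γ).1 i j).contDiffAt (isOpen_puncturedDisk.mem_nhds ht)

theorem re_trace_gram_inv_mul_gram_le (hKcont : D.IsContinuousMetric K)
    (hK'cont : D.IsContinuousMetric K') (hKharm : D.IsHarmonicMetric K)
    (hK'harm : D.IsHarmonicMetric K')
    (hboundary : ∀ x : D.closedPunctured, ‖D.chart (x : X)‖ = 1 → K x = K' x)
    (hKbdd : MutuallyBoundedOn K K₀ D.punctured) (hK'bdd : MutuallyBoundedOn K' K₀ D.punctured)
    (γ : Path.Homotopic.Quotient D.center x₀) {t : ℂ} (ht : t ∈ closedPuncturedDisk) :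
    ((D.gram K γ t)⁻¹ * D.gram K' γ t).trace.re ≤ n := by
  obtain ⟨a, ha⟩ := exists_posSemidef_smul_gram_sub_gram hKbdd hK'bdd γ
  refine re_trace_inv_mul_le_on_closedPuncturedDisk (B := a * n) (hKcont γ) (hK'cont γ)
    (fun t ht => posDef_gram K ht) (fun t ht => posDef_gram K' ht)
    (fun t ht => hKharm.entrywiseContDiffAt γ ht) (fun t ht => hK'harm.entrywiseContDiffAt γ ht)
    (hKharm γ).2 (hK'harm γ).2 (fun t ht => ?_)
    (fun t ht => re_trace_inv_mul_le (posDef_gram K ⟨ht.1, ht.2.le⟩) (ha t ht)) ht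
  have ht' : t ∈ closedPuncturedDisk := ⟨by rw [ht]; exact one_pos, ht.le⟩
  rw [gram_eq K ht', gram_eq K' ht', hboundary _ ?_]
  simpa only [point, D.chart.right_inv (D.mem_target ht')] using ht

end CoordinateDisk

end FlatHarmonic

theorem lemma1 {X : Type*} [TopologicalSpace X] [T2Space X] [CompactSpace X] [ConnectedSpace X]
    [ChartedSpace ℂ X] [IsManifold 𝓘(ℂ) ω X] {x₀ : X} {n : ℕ}
    (ρ : FundamentalGroup X x₀ →* GL (Fin n) ℂ)
    (D : FlatHarmonic.CoordinateDisk X)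
    (K₀ K K' : FlatHarmonic.HermitianMetric ρ D.closedPunctured)
    (hKcont : D.IsContinuousMetric K) (hK'cont : D.IsContinuousMetric K')
    (hKharm : D.IsHarmonicMetric K) (hK'harm : D.IsHarmonicMetric K')
    (hboundary : ∀ x : D.closedPunctured, ‖D.chart (x : X)‖ = 1 → K x = K' x)
    (hKbdd : FlatHarmonic.MutuallyBoundedOn K K₀ D.punctured)
    (hK'bdd : FlatHarmonic.MutuallyBoundedOn K' K₀ D.punctured) :
    K = K' := by
  have : LocallyPathConnectedSpace X := ChartedSpace.locallyPathConnectedSpace ℂ X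
  have : PathConnectedSpace X := pathConnectedSpace_iff_connectedSpace.2 inferInstance
  let γ : Path.Homotopic.Quotient D.center x₀ :=
    Path.Homotopic.Quotient.mk (PathConnectedSpace.somePath D.center x₀)
  have hpoint : ∀ t (ht : t ∈ FlatHarmonic.closedPuncturedDisk),
      K ⟨D.point t, D.point_mem ht⟩ = K' ⟨D.point t, D.point_mem ht⟩ := fun t ht =>
    FlatHarmonic.CoordinateDisk.core_eq_of_gram_eq (γ := γ) ht <|
      FlatHarmonic.eq_of_re_trace_inv_mul_le
        (FlatHarmonic.CoordinateDisk.posDef_gram K ht)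
        (FlatHarmonic.CoordinateDisk.posDef_gram K' ht)
        (FlatHarmonic.CoordinateDisk.re_trace_gram_inv_mul_gram_le hKcont hK'cont hKharm hK'harm
          hboundary hKbdd hK'bdd γ ht)
        (FlatHarmonic.CoordinateDisk.re_trace_gram_inv_mul_gram_le hK'cont hKcont hK'harm hKharm
          (fun x hx => (hboundary x hx).symm) hK'bdd hKbdd γ ht)
  funext x
  have hx : x = ⟨D.point (D.chart x), D.point_mem x.2.2⟩ :=
    Subtype.ext (D.chart.left_inv x.2.1).symm
  rw [hx]
  exact hpoint _ x.2.2
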